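/- Let $R$ be a commutative Noetherian local integrally closed (normal) domain of positive Krull dimension, with fraction field $Q(R)$. For an arbitrary (not necessarily finitely generated) $R$-module $\mathcal M$ put $\mathcal M_0:=\mathcal M\otimes_R Q(R)$. Call $\mathcal M$ \emph{quasi-reflexive} if $$\mathcal M=\bigcap_{\mathfrak p\in\operatorname{Spec}(R),\ \operatorname{ht}(\mathfrak p)=1}\mathcal M_{\mathfrak p}\quad\text{in }\mathcal M_0,$$ that is, the canonical map $\mathcal M\to\mathcal M_0$ is injective and its image is the intersection of the images of the canonical maps $\mathcal M_{\mathfrak p}\to\mathcal M_0$ over all primes $\mathfrak p$ of height one. Then the following are equivalent: 1. every quasi-reflexive $R$-module is flat; 2. an $R$-module is quasi-reflexive if and only if it is flat; 3. $R$ is a regular local ring of dimension at most two. -/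

import Mathlib

open scoped TensorProduct nonZeroDivisors

universe u v

section

variable (R : Type u) [CommRing R] [IsDomain R] (M : Type v) [AddCommGroup M] [Module R M]

/-- The canonical map `m ↦ 1 ⊗ m` from a module `M` over a domain `R` to `M₀ = Q(R) ⊗ M`,
where `Q(R)` is the fraction field of `R`. -/
noncomputable def toGeneric : M →ₗ[R] FractionRing R ⊗[R] M :=
  TensorProduct.mk R (FractionRing R) M 1

instance isLocalizedModule_toGeneric : IsLocalizedModule R⁰ (toGeneric R M) :=
  inferInstanceAs (IsLocalizedModule R⁰ (TensorProduct.mk R (FractionRing R) M 1))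

/-- The canonical map `m / s ↦ s⁻¹ ⊗ m` from the localization `M_p` of `M` at a prime `p`
to `M₀ = Q(R) ⊗ M`. -/
noncomputable def localizedToGeneric (p : Ideal R) [p.IsPrime] :
    LocalizedModule p.primeCompl M →ₗ[R] FractionRing R ⊗[R] M :=
  IsLocalizedModule.liftOfLE p.primeCompl R⁰ p.primeCompl_le_nonZeroDivisors
    (LocalizedModule.mkLinearMap p.primeCompl M) (toGeneric R M)

/-- A module `M` over a domain `R` is quasi-reflexive if `M` is the intersection of its
localizations `M_p` at the primes `p` of height one, computed in `M₀ = Q(R) ⊗ M`. In particular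
the canonical map from `M` to `M₀` is injective. -/
structure IsQuasiReflexive : Prop where
  injective : Function.Injective (toGeneric R M)
  range_eq : LinearMap.range (toGeneric R M) =
    ⨅ p : {p : PrimeSpectrum R // p.asIdeal.height = 1},
      LinearMap.range (localizedToGeneric R M p.1.asIdeal)

end

/-! ### Quasi-reflexivity without fractions. -/

section QuasiReflexive

variable {R : Type u} [CommRing R] [IsDomain R] {M : Type v} [AddCommGroup M] [Module R M]

/-! Flat implies quasi-reflexive over any Noetherian normal domain: the associated primes of `R/(s)`
have height one, so an element of `M` divisible by `s` at all of them is divisible by `s`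
(`isQuasiReflexive_of_flat`).

Conversely, flatness over a Noetherian ring can be tested on primes. In a regular local ring of
dimension at most two, a prime is principal or is the maximal ideal `(x, y)`. Torsion-freeness
settles the first case. In the second, no height-one prime contains both `x` and `y`, so they form a
weakly regular sequence on a quasi-reflexive module.

If all quasi-reflexive modules are flat, height-one primes are free, hence principal, and `R` is a
UFD. Were the embedding dimension at least three, the syzygies of three independent elements of the
cotangent space would be quasi-reflexive, hence free of rank two; a Hilbert–Burch computation
excludes this (`relations_not_generated_by_two`). -/

lemma toGeneric_injective_iff :
    Function.Injective (toGeneric R M) ↔ ∀ (s : R) (m : M), s ≠ 0 → s • m = 0 → m = 0 := by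
  rw [injective_iff_map_eq_zero]
  refine ⟨fun h s m hs hm ↦ h m ?_, fun h m hm ↦ ?_⟩
  · rw [IsLocalizedModule.eq_zero_iff R⁰ (toGeneric R M)]
    exact ⟨⟨s, mem_nonZeroDivisors_of_ne_zero hs⟩, hm⟩
  · rw [IsLocalizedModule.eq_zero_iff R⁰ (toGeneric R M)] at hm
    obtain ⟨s, hs⟩ := hm
    exact h s m (nonZeroDivisors.ne_zero s.2) hs

lemma mk'_mem_range_localizedToGeneric_iff
    (hM : ∀ (s : R) (m : M), s ≠ 0 → s • m = 0 → m = 0) (p : Ideal R) [p.IsPrime]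
    (m : M) (s : R⁰) :
    IsLocalizedModule.mk' (toGeneric R M) m s ∈ LinearMap.range (localizedToGeneric R M p) ↔
      ∃ t ∉ p, ∃ m' : M, t • m = (s : R) • m' := by
  constructor
  · rintro ⟨z, hz⟩
    obtain ⟨⟨m', t⟩, rfl⟩ := IsLocalizedModule.mk'_surjective p.primeCompl
      (LocalizedModule.mkLinearMap p.primeCompl M) z
    rw [Function.uncurry, localizedToGeneric, IsLocalizedModule.liftOfLE_mk',
      IsLocalizedModule.mk'_eq_mk'_iff] at hz
    obtain ⟨c, hc⟩ := hz
    refine ⟨t, t.2, m', sub_eq_zero.1 <| hM c _ (nonZeroDivisors.ne_zero c.2) ?_⟩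
    rw [smul_sub, sub_eq_zero]
    exact hc
  · rintro ⟨t, ht, m', h⟩
    refine ⟨IsLocalizedModule.mk' (LocalizedModule.mkLinearMap p.primeCompl M) m'
      (⟨t, ht⟩ : p.primeCompl), ?_⟩
    rw [localizedToGeneric, IsLocalizedModule.liftOfLE_mk', IsLocalizedModule.mk'_eq_mk'_iff]
    exact ⟨1, by simpa [Submonoid.smul_def] using h⟩

lemma mk'_mem_range_toGeneric_iff
    (hM : ∀ (s : R) (m : M), s ≠ 0 → s • m = 0 → m = 0) (m : M) (s : R⁰) :
    IsLocalizedModule.mk' (toGeneric R M) m s ∈ LinearMap.range (toGeneric R M) ↔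
      ∃ m' : M, m = (s : R) • m' := by
  refine exists_congr fun m' ↦ ?_
  rw [eq_comm, IsLocalizedModule.mk'_eq_iff, Submonoid.smul_def, ← map_smul]
  exact (toGeneric_injective_iff.2 hM).eq_iff

variable (R M) in
/-- An elementwise description of quasi-reflexive modules. -/
theorem isQuasiReflexive_iff :
    IsQuasiReflexive R M ↔ (∀ (s : R) (m : M), s ≠ 0 → s • m = 0 → m = 0) ∧
      ∀ (s : R) (m : M), s ≠ 0 →
        (∀ p : Ideal R, p.IsPrime → p.height = 1 → ∃ t ∉ p, ∃ m' : M, t • m = s • m') →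
        ∃ m' : M, m = s • m' := by
  constructor
  · rintro ⟨hinj, hr⟩
    have hM := toGeneric_injective_iff.1 hinj
    refine ⟨hM, fun s m hs h ↦ ?_⟩
    have hs' := mem_nonZeroDivisors_of_ne_zero hs
    rw [← mk'_mem_range_toGeneric_iff hM m ⟨s, hs'⟩, hr, Submodule.mem_iInf]
    exact fun p ↦ (mk'_mem_range_localizedToGeneric_iff hM _ m ⟨s, hs'⟩).2 (h _ p.1.2 p.2)
  · rintro ⟨hM, h⟩
    refine ⟨toGeneric_injective_iff.2 hM, SetLike.ext fun z ↦ ?_⟩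
    obtain ⟨⟨m, s⟩, rfl⟩ := IsLocalizedModule.mk'_surjective R⁰ (toGeneric R M) z
    rw [Function.uncurry, mk'_mem_range_toGeneric_iff hM, Submodule.mem_iInf]
    constructor
    · rintro ⟨m', hm'⟩ p
      refine (mk'_mem_range_localizedToGeneric_iff hM _ m s).2
        ⟨1, (Ideal.ne_top_iff_one _).1 p.1.2.ne_top, m', by simpa using hm'⟩
    · intro hp
      exact h s m (nonZeroDivisors.ne_zero s.2) fun p hpp hp1 ↦
        (mk'_mem_range_localizedToGeneric_iff hM _ m s).1 (hp ⟨⟨p, hpp⟩, hp1⟩)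

lemma IsQuasiReflexive.of_linearEquiv {N : Type*} [AddCommGroup N] [Module R N] (e : M ≃ₗ[R] N)
    (h : IsQuasiReflexive R M) : IsQuasiReflexive R N := by
  rw [isQuasiReflexive_iff] at h ⊢
  refine ⟨fun s n hs hn ↦ ?_, fun s n hs hn ↦ ?_⟩
  · rw [← e.symm.map_eq_zero_iff]
    exact h.1 s _ hs (by rw [← map_smul, hn, map_zero])
  · obtain ⟨m', hm'⟩ := h.2 s (e.symm n) hs fun p hp hp1 ↦ by
      obtain ⟨t, ht, n', hn'⟩ := hn p hp hp1
      exact ⟨t, ht, e.symm n', by rw [← map_smul, hn', map_smul]⟩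
    exact ⟨e m', by rw [← map_smul, ← hm', e.apply_symm_apply]⟩

/-- If `a, b` do not lie in a common prime of height one, then `a, b` is a regular sequence on
every quasi-reflexive module. -/
lemma IsQuasiReflexive.exists_eq_smul_of_smul_eq_smul (h : IsQuasiReflexive R M) {a b : R}
    (ha : a ≠ 0) (hab : ∀ p : Ideal R, p.IsPrime → p.height = 1 → a ∈ p → b ∉ p) {m n : M}
    (hmn : b • m = a • n) : ∃ m', m = a • m' := by
  refine ((isQuasiReflexive_iff R M).1 h).2 a m ha fun p hp hp1 ↦ ?_
  by_cases hap : a ∈ p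
  · exact ⟨b, hab p hp hp1 hap, n, hmn⟩
  · exact ⟨a, hap, m, rfl⟩

/-- A submodule `N` of a quasi-reflexive module `M` with `M ⧸ N` torsion-free is
quasi-reflexive. -/
lemma IsQuasiReflexive.submodule (h : IsQuasiReflexive R M) (N : Submodule R M)
    (hN : ∀ (s : R) (m : M), s ≠ 0 → s • m ∈ N → m ∈ N) : IsQuasiReflexive R N := by
  rw [isQuasiReflexive_iff] at h ⊢
  refine ⟨fun s n hs hn ↦ Subtype.ext (h.1 s n hs (congrArg Subtype.val hn)), fun s n hs hn ↦ ?_⟩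
  obtain ⟨m', hm'⟩ := h.2 s n hs fun p hp hp1 ↦ by
    obtain ⟨t, ht, n', hn'⟩ := hn p hp hp1
    exact ⟨t, ht, n', congrArg Subtype.val hn'⟩
  exact ⟨⟨m', hN s m' hs (hm' ▸ n.2)⟩, Subtype.ext hm'⟩

end QuasiReflexive

/-! ### Normality: associated primes of principal ideals and flat modules. -/

section Normal

variable {R : Type u} [CommRing R] [IsDomain R] [IsNoetherianRing R] [IsIntegrallyClosed R]

/-- In a Noetherian normal domain, the associated primes of a principal ideal have height one. -/
lemma height_eq_one_of_mem_associatedPrimes {s : R} (hs : s ≠ 0) {p : Ideal R}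
    (hp : p ∈ associatedPrimes R (R ⧸ Ideal.span {s})) : p.height = 1 := by
  rw [AssociatedPrimes.mem_iff, isAssociatedPrime_iff] at hp
  obtain ⟨hpp, x, hx⟩ := hp
  obtain ⟨a, rfl⟩ := Ideal.Quotient.mk_surjective x
  have hmem (r : R) : r ∈ p ↔ s ∣ r * a := by
    rw [hx, Submodule.mem_colon_singleton, Submodule.mem_bot, ← Ideal.mem_span_singleton,
      ← Ideal.Quotient.eq_zero_iff_mem, map_mul]
    rfl
  have hsp : s ∈ p := (hmem s).2 (dvd_mul_right s a)
  have hsa : ¬ s ∣ a := fun h ↦ hpp.ne_top ((Ideal.eq_top_iff_one p).2 ((hmem 1).2 (by simpa)))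
  -- Multiplication by `a/s` maps `p` into `R`. If it mapped `p` into `p`, then `a/s` would be
  -- integral, hence in `R`, against `hsa`.
  obtain ⟨t, htp, v, hv, hvp⟩ : ∃ t ∈ p, ∃ v, t * a = s * v ∧ v ∉ p := by
    by_contra! hcon
    have hsK : algebraMap R (FractionRing R) s ≠ 0 := by simpa using hs
    let N : Submodule R (FractionRing R) := Submodule.map (Algebra.linearMap R (FractionRing R)) p
    have hN : N ≠ ⊥ := fun h ↦ hsK <| (Submodule.mem_bot R).1 <| h ▸
      Submodule.mem_map_of_mem (f := Algebra.linearMap R (FractionRing R)) hsp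
    have hint : IsIntegral R (algebraMap R (FractionRing R) a / algebraMap R (FractionRing R) s) := by
      refine isIntegral_of_smul_mem_submodule (M := (FractionRing R)) N hN
        (Submodule.FG.map _ (IsNoetherian.noetherian p)) _ ?_
      rintro _ ⟨t, ht, rfl⟩
      obtain ⟨v, hv⟩ := (hmem t).1 ht
      refine ⟨v, hcon t ht v hv, ?_⟩
      have := congrArg (algebraMap R (FractionRing R)) hv
      simp only [map_mul] at this
      simp only [Algebra.linearMap_apply, smul_eq_mul]
      field_simp
      rw [mul_comm, ← this, mul_comm]
    obtain ⟨c, hc⟩ := IsIntegrallyClosed.isIntegral_iff.1 hint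
    refine hsa ⟨c, FaithfulSMul.algebraMap_injective R (FractionRing R) ?_⟩
    rw [map_mul, hc, mul_div_cancel₀ _ hsK]
  -- Each `r ∈ p` satisfies `r * v = w * t` with `v ∉ p`, so `t` generates `p` locally at `p`, and
  -- Krull's principal ideal theorem applies.
  have hmin : p ∈ (Ideal.span {t}).minimalPrimes := by
    refine ⟨⟨hpp, (Ideal.span_singleton_le_iff_mem p).2 htp⟩, fun q ⟨hq, htq⟩ hqp r hr ↦ ?_⟩
    obtain ⟨w, hw⟩ := (hmem r).1 hr
    have : r * v = w * t := mul_left_cancel₀ hs (by linear_combination t * hw - r * hv)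
    have hrv : r * v ∈ q := this ▸ q.mul_mem_left w (htq (Ideal.mem_span_singleton_self t))
    exact (hq.mem_or_mem hrv).resolve_right fun h ↦ hvp (hqp h)
  refine le_antisymm (Ideal.height_le_one_of_isPrincipal_of_mem_minimalPrimes _ p hmin) ?_
  rw [Order.one_le_iff_ne_zero, Ne, Ideal.height_eq_zero_iff_eq_bot]
  rintro rfl
  exact hs hsp

/-- Flat modules over a Noetherian normal domain are quasi-reflexive. -/
theorem isQuasiReflexive_of_flat (M : Type v) [AddCommGroup M] [Module R M] [Module.Flat R M] :
    IsQuasiReflexive R M := by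
  have hM := toGeneric_injective_iff.1
    (Module.Flat.tensorProduct_mk_injective (R := R) (S := FractionRing R) M)
  refine (isQuasiReflexive_iff R M).2 ⟨hM, fun s m hs h ↦ ?_⟩
  let P : Submodule R M := Ideal.span {s} • ⊤
  have hmemP (n : M) : n ∈ P ↔ ∃ m', n = s • m' := by
    simp [P, Submodule.ideal_span_singleton_smul, Submodule.mem_smul_pointwise_iff_exists, eq_comm]
  let J : Ideal R := P.colon {m}
  -- By prime avoidance: `J` lies in no associated prime of `R/(s)`. Flatness then makes `t` regular
  -- on `M/sM`, where it kills the class of `m`.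
  obtain ⟨t, htJ, ht⟩ : ∃ t ∈ J, IsSMulRegular (R ⧸ Ideal.span {s}) t := by
    by_contra! hcon
    have hsub : (J : Set R) ⊆ ⋃ p ∈ associatedPrimes R (R ⧸ Ideal.span {s}), id p := by
      intro t ht
      simp only [id]
      rw [biUnion_associatedPrimes_eq_compl_regular]
      exact hcon t ht
    obtain ⟨p, hp, hJp⟩ := (Ideal.subset_union_prime_finite
      (associatedPrimes.finite R (R ⧸ Ideal.span {s})) (f := id) 0 0
      fun _ h _ _ ↦ h.isPrime).1 hsub
    obtain ⟨t, ht, ht'⟩ := h p hp.isPrime (height_eq_one_of_mem_associatedPrimes hs hp)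
    exact ht (hJp (Submodule.mem_colon_singleton.2 ((hmemP _).2 ht')))
  have hreg : IsSMulRegular ((R ⧸ Ideal.span {s}) ⊗[R] M) t := ht.rTensor M
  rw [← hmemP]
  have hker := LinearMap.ker_tensorProductMk (R := R) (Q := M) (I := Ideal.span {s})
  change m ∈ (Ideal.span {s} • ⊤ : Submodule R M)
  rw [← hker, LinearMap.mem_ker]
  refine hreg.right_eq_zero_of_smul ?_
  rw [← map_smul, ← LinearMap.mem_ker, hker]
  exact Submodule.mem_colon_singleton.1 htJ

/-- A prime of height one of a Noetherian normal domain is quasi-reflexive. -/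
lemma isQuasiReflexive_of_height_eq_one (q : Ideal R) [q.IsPrime] (hq : q.height = 1) :
    IsQuasiReflexive R q := by
  have hR := (isQuasiReflexive_iff R R).1 (isQuasiReflexive_of_flat R)
  refine (isQuasiReflexive_iff R q).2
    ⟨fun s n hs hn ↦ Subtype.ext (hR.1 s n hs (congrArg Subtype.val hn)), fun s n hs hn ↦ ?_⟩
  obtain ⟨m', hm'⟩ := hR.2 s n hs fun p hp hp1 ↦ by
    obtain ⟨t, ht, n', hn'⟩ := hn p hp hp1
    exact ⟨t, ht, n', congrArg Subtype.val hn'⟩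
  -- So far the quotient `m'` lies only in `R`; the condition at `q` itself forces it into `q`.
  obtain ⟨t, ht, n', hn'⟩ := hn q inferInstance hq
  replace hn' : t * (n : R) = s * n' := congrArg Subtype.val hn'
  have htm : t * m' = n' := mul_left_cancel₀ hs (by
    rw [← hn', hm', smul_eq_mul]; ring)
  have hmq : m' ∈ q := ((‹q.IsPrime›.mem_or_mem (htm ▸ n'.2 : t * m' ∈ q))).resolve_left ht
  exact ⟨⟨m', hmq⟩, Subtype.ext hm'⟩

end Normal

/-! ### Testing flatness on primes. -/

section FlatCriterion

variable {R : Type u} [CommRing R] (M : Type v) [AddCommGroup M] [Module R M]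

/-- If `p = (I : a)` and `p ⊗ M → M` is injective, then so is `I ⊗ M → (I + (a)) ⊗ M`. -/
lemma rTensor_inclusion_sup_span_singleton_injective (I p : Ideal R) (a : R)
    (hp : ∀ r, r ∈ p ↔ r * a ∈ I) (hpM : Function.Injective (p.subtype.rTensor M)) :
    Function.Injective
      ((Submodule.inclusion (le_sup_left : I ≤ I ⊔ Ideal.span {a})).rTensor M) := by
  let J : Ideal R := I ⊔ Ideal.span {a}
  have haJ : a ∈ J := Ideal.mem_sup_right (Ideal.mem_span_singleton_self a)
  let φ : p →ₗ[R] I :=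
    LinearMap.codRestrict I ((LinearMap.mulRight R a).comp p.subtype) fun r ↦ (hp r).1 r.2
  have hφ (q : p) : (φ q : R) = q * a := rfl
  -- The presentation `p → I × R → J → 0` stays exact after tensoring. A kernel element `z`, placed
  -- in the first factor, comes from some `w`; its second component shows that `w` dies in `M`, so
  -- `w = 0` and `z = 0`.
  let f : p →ₗ[R] I × R := φ.prod (-p.subtype)
  let g : I × R →ₗ[R] J :=
    (Submodule.inclusion le_sup_left).coprod (LinearMap.toSpanSingleton R J ⟨a, haJ⟩)
  have hg : Function.Surjective g := by
    rintro ⟨j, hj⟩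
    obtain ⟨i, hi, k, hk, rfl⟩ := Submodule.mem_sup.1 hj
    obtain ⟨r, rfl⟩ := Ideal.mem_span_singleton'.1 hk
    exact ⟨(⟨i, hi⟩, r), Subtype.ext (by simp [g])⟩
  have hfg : Function.Exact f g := by
    rintro ⟨i, r⟩
    have : g (i, r) = 0 ↔ (i : R) + r * a = 0 := by simp [g, Subtype.ext_iff]
    rw [this]
    constructor
    · intro h
      have hr : -r ∈ p := (hp _).2 (by
        rw [neg_mul, ← eq_neg_of_add_eq_zero_left h]; exact i.2)
      refine ⟨⟨-r, hr⟩, Prod.ext (Subtype.ext ?_) ?_⟩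
      · simp [f, hφ, eq_neg_of_add_eq_zero_left h]
      · simp [f]
    · rintro ⟨q, hq⟩
      obtain ⟨rfl, rfl⟩ := Prod.ext_iff.1 hq
      simp [f, hφ]
  have hex := rTensor_exact M hfg hg
  rw [injective_iff_map_eq_zero]
  intro z hz
  have hz' : g.rTensor M ((LinearMap.inl R I R).rTensor M z) = 0 := by
    rw [← LinearMap.comp_apply, ← LinearMap.rTensor_comp, LinearMap.coprod_inl, hz]
  obtain ⟨w, hw⟩ := (hex _).1 hz'
  have hw0 : w = 0 := by
    refine (injective_iff_map_eq_zero _).1 hpM w (neg_eq_zero.1 ?_)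
    have := congrArg ((LinearMap.snd R I R).rTensor M) hw
    rw [← LinearMap.comp_apply, ← LinearMap.comp_apply, ← LinearMap.rTensor_comp,
      ← LinearMap.rTensor_comp, LinearMap.snd_comp_inl, LinearMap.snd_prod,
      LinearMap.rTensor_neg, LinearMap.rTensor_zero] at this
    simpa using this
  have := congrArg ((LinearMap.fst R I R).rTensor M) hw
  rw [hw0, map_zero, map_zero, ← LinearMap.comp_apply, ← LinearMap.rTensor_comp,
    LinearMap.fst_comp_inl, LinearMap.rTensor_id] at this
  exact this.symm

/-- Over a Noetherian ring, a module `M` is flat as soon as `p ⊗ M → M` is injective for all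
primes `p`. -/
theorem flat_of_forall_isPrime_rTensor_injective [IsNoetherianRing R]
    (h : ∀ p : Ideal R, p.IsPrime → Function.Injective (p.subtype.rTensor M)) :
    Module.Flat R M := by
  rw [Module.Flat.iff_rTensor_injective']
  intro I
  induction I using IsNoetherian.induction with
  | hgt I ih =>
    by_cases hI : I = ⊤
    · subst hI
      exact (LinearEquiv.rTensor M (Submodule.topEquiv (R := R) (M := R))).injective
    · have : Nontrivial (R ⧸ I) := Ideal.Quotient.nontrivial_iff.2 hI
      -- An associated prime `p = (I : a)` links `I` to the strictly larger ideal `I + (a)`, covered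
      -- by induction.
      obtain ⟨p, hp⟩ := associatedPrimes.nonempty R (R ⧸ I)
      have hpp := hp.isPrime
      rw [AssociatedPrimes.mem_iff, isAssociatedPrime_iff] at hp
      obtain ⟨-, x, hx⟩ := hp
      obtain ⟨a, rfl⟩ := Ideal.Quotient.mk_surjective x
      have hmem (r : R) : r ∈ p ↔ r * a ∈ I := by
        rw [hx, Submodule.mem_colon_singleton, Submodule.mem_bot,
          ← Ideal.Quotient.eq_zero_iff_mem, map_mul]
        rfl
      have haI : a ∉ I := fun ha ↦ hpp.ne_top
        ((Ideal.eq_top_iff_one p).2 ((hmem 1).2 (by simpa using ha)))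
      have hlt : I < I ⊔ Ideal.span {a} := by
        refine lt_of_le_of_ne le_sup_left fun heq ↦ haI ?_
        rw [heq]
        exact Ideal.mem_sup_right (Ideal.mem_span_singleton_self a)
      have hcomp : I.subtype.rTensor M = (Submodule.subtype (I ⊔ Ideal.span {a})).rTensor M ∘ₗ
          (Submodule.inclusion (le_sup_left : I ≤ I ⊔ Ideal.span {a})).rTensor M := by
        rw [← LinearMap.rTensor_comp, Submodule.subtype_comp_inclusion]
      rw [hcomp]
      exact (ih _ hlt).comp
        (rTensor_inclusion_sup_span_singleton_injective M I p a hmem (h p hpp))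

variable {M}

/-- `I ⊗ M → M` is injective if `I = (a)` and `a` is regular on `M`. -/
lemma rTensor_subtype_span_singleton_injective {I : Ideal R} {a : R} (hI : I = Ideal.span {a})
    (ha : ∀ m : M, a • m = 0 → m = 0) : Function.Injective (I.subtype.rTensor M) := by
  have haI : a ∈ I := hI ▸ Ideal.mem_span_singleton_self a
  have key (z : I ⊗[R] M) : ∃ m : M, z = (⟨a, haI⟩ : I) ⊗ₜ m := by
    induction z with
    | zero => exact ⟨0, by simp⟩
    | tmul i m =>
      obtain ⟨r, hr⟩ := Ideal.mem_span_singleton'.1 (hI.le i.2)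
      refine ⟨r • m, ?_⟩
      rw [← TensorProduct.smul_tmul]
      exact congrArg (· ⊗ₜ m) (Subtype.ext hr.symm)
    | add z w hz hw =>
      obtain ⟨m, rfl⟩ := hz
      obtain ⟨n, rfl⟩ := hw
      exact ⟨m + n, (TensorProduct.tmul_add _ _ _).symm⟩
  rw [injective_iff_map_eq_zero]
  intro z hz
  obtain ⟨m, rfl⟩ := key z
  have h0 : a • m = 0 := by simpa using congrArg (TensorProduct.lid R M) hz
  rw [ha m h0, TensorProduct.tmul_zero]

/-- `I ⊗ M → M` is injective if `I = (a, b)` and `a, b` is a regular sequence on `M`. -/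
lemma rTensor_subtype_span_pair_injective {I : Ideal R} {a b : R} (hI : I = Ideal.span {a, b})
    (ha : ∀ m : M, a • m = 0 → m = 0)
    (hab : ∀ m n : M, b • m = a • n → ∃ m', m = a • m') :
    Function.Injective (I.subtype.rTensor M) := by
  have haI : a ∈ I := hI ▸ Ideal.subset_span (by simp)
  have hbI : b ∈ I := hI ▸ Ideal.subset_span (by simp)
  have key (z : I ⊗[R] M) : ∃ m n : M, z = (⟨a, haI⟩ : I) ⊗ₜ m + (⟨b, hbI⟩ : I) ⊗ₜ n := by
    induction z with
    | zero => exact ⟨0, 0, by simp⟩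
    | tmul i m =>
      obtain ⟨r, s, hr⟩ := Ideal.mem_span_pair.1 (hI.le i.2)
      refine ⟨r • m, s • m, ?_⟩
      rw [← TensorProduct.smul_tmul, ← TensorProduct.smul_tmul, ← TensorProduct.add_tmul]
      exact congrArg (· ⊗ₜ m) (Subtype.ext hr.symm)
    | add z w hz hw =>
      obtain ⟨m, n, rfl⟩ := hz
      obtain ⟨m', n', rfl⟩ := hw
      exact ⟨m + m', n + n', by simp only [TensorProduct.tmul_add]; abel⟩
  rw [injective_iff_map_eq_zero]
  intro z hz
  obtain ⟨m, n, rfl⟩ := key z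
  have h0 : a • m + b • n = 0 := by simpa using congrArg (TensorProduct.lid R M) hz
  obtain ⟨m', rfl⟩ := hab n (-m) (by rw [smul_neg, eq_neg_of_add_eq_zero_right h0])
  obtain rfl : m = -(b • m') := by
    refine eq_neg_of_add_eq_zero_left (ha _ ?_)
    rw [smul_add, ← h0, smul_comm]
  have hswap : b • (⟨a, haI⟩ : I) = a • (⟨b, hbI⟩ : I) := Subtype.ext (mul_comm b a)
  rw [TensorProduct.tmul_neg, ← TensorProduct.smul_tmul, ← TensorProduct.smul_tmul, hswap,
    neg_add_cancel]

end FlatCriterion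

/-! ### Primes when the maximal ideal has two generators. -/

section RegularDimensionTwo

open IsLocalRing

variable {R : Type u} [CommRing R] [IsNoetherianRing R] [IsLocalRing R]

/-- If the maximal ideal is `(x, y)`, then every element outside `(x)` is, modulo `x`, a unit times
a power of `y`. -/
lemma exists_isUnit_mul_pow_add_mul {x y : R} (hxy : maximalIdeal R = Ideal.span {x, y}) {a : R}
    (ha : a ∉ Ideal.span {x}) : ∃ n u b, IsUnit u ∧ a = u * y ^ n + x * b := by
  classical
  have hy : y ∈ maximalIdeal R := hxy ▸ Ideal.subset_span (by simp)
  -- Krull's intersection theorem in `R/(x)`: `a` is not divisible by all powers of `y` modulo `x`.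
  -- The coefficient at the last power that works must be a unit.
  have hex : ∃ n, ¬ ∃ c b, a = c * y ^ n + x * b := by
    by_contra! hcon
    apply ha
    have hI : Ideal.span {y} ≠ ⊤ := fun h ↦ (mem_maximalIdeal y).1 hy (Ideal.span_singleton_eq_top.1 h)
    rw [← Ideal.Quotient.eq_zero_iff_mem, ← Submodule.mem_bot (R := R),
      ← Ideal.iInf_pow_smul_eq_bot_of_isLocalRing (M := R ⧸ Ideal.span {x}) _ hI,
      Submodule.mem_iInf]
    intro n
    obtain ⟨c, b, h⟩ := hcon n
    have : Ideal.Quotient.mk (Ideal.span {x}) a = y ^ n • Ideal.Quotient.mk (Ideal.span {x}) c := by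
      change _ = Ideal.Quotient.mk (Ideal.span {x}) (y ^ n * c)
      rw [Ideal.Quotient.eq, Ideal.mem_span_singleton]
      exact ⟨b, by rw [h]; ring⟩
    rw [this, Ideal.span_singleton_pow]
    exact Submodule.smul_mem_smul (Ideal.mem_span_singleton_self _) Submodule.mem_top
  have hn := Nat.find_spec hex
  obtain ⟨n, hn'⟩ : ∃ n, Nat.find hex = n + 1 := by
    refine Nat.exists_eq_succ_of_ne_zero fun h0 ↦ ?_
    rw [h0] at hn
    exact hn ⟨a, 0, by simp⟩
  obtain ⟨c, b, hcb⟩ := not_not.1 (Nat.find_min hex (n.lt_succ_self.trans_eq hn'.symm))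
  refine ⟨n, c, b, ?_, hcb⟩
  by_contra hc
  have hc' : c ∈ maximalIdeal R := hc
  rw [hxy] at hc'
  obtain ⟨r, s, rfl⟩ := Ideal.mem_span_pair.1 hc'
  exact hn ⟨s, r * y ^ n + b, by rw [hn', hcb]; ring⟩

/-- If the maximal ideal is `(x, y)`, then every prime not containing `x` is principal. -/
lemma isPrincipal_of_notMem {x y : R} (hxy : maximalIdeal R = Ideal.span {x, y}) (p : Ideal R)
    [hp : p.IsPrime] (hx : x ∉ p) : p.IsPrincipal := by
  classical
  have hxm : Ideal.span {x} ≤ maximalIdeal R :=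
    (Ideal.span_singleton_le_iff_mem _).2 (hxy ▸ Ideal.subset_span (by simp))
  have hxp (r : R) (hr : x * r ∈ p) : x * r ∈ Ideal.span {x} • p :=
    Submodule.smul_mem_smul (Ideal.mem_span_singleton_self x) ((hp.mem_or_mem hr).resolve_left hx)
  by_cases hle : p ≤ Ideal.span {x}
  · have : p = ⊥ := by
      refine Submodule.eq_bot_of_le_smul_of_le_jacobson_bot (Ideal.span {x}) p
        (IsNoetherian.noetherian p) (fun a ha ↦ ?_) (hxm.trans (maximalIdeal_le_jacobson _))
      obtain ⟨r, rfl⟩ := Ideal.mem_span_singleton.1 (hle ha)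
      exact hxp r ha
    exact this ▸ inferInstance
  · obtain ⟨a, ha, hax⟩ := Set.not_subset.1 hle
    -- An element `f ∈ p` of least `y`-order modulo `x` divides all of `p` modulo `x`. The
    -- remainders lie in `p ∩ (x) = xp`, so Nakayama gives `p = (f)`.
    have hex : ∃ n, ∃ u b, IsUnit u ∧ u * y ^ n + x * b ∈ p := by
      obtain ⟨n, u, b, hu, rfl⟩ := exists_isUnit_mul_pow_add_mul hxy hax
      exact ⟨n, u, b, hu, ha⟩
    obtain ⟨u, b, hu, hf⟩ := Nat.find_spec hex
    set k := Nat.find hex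
    set f := u * y ^ k + x * b
    refine ⟨f, le_antisymm ?_ ((Ideal.span_singleton_le_iff_mem p).2 hf)⟩
    refine Submodule.le_of_le_smul_of_le_jacobson_bot (I := Ideal.span {x})
      (IsNoetherian.noetherian p) (hxm.trans (maximalIdeal_le_jacobson _)) fun c hc ↦ ?_
    by_cases hcx : c ∈ Ideal.span {x}
    · obtain ⟨r, rfl⟩ := Ideal.mem_span_singleton.1 hcx
      exact Submodule.mem_sup_right (hxp r hc)
    · obtain ⟨n, w, d, hw, rfl⟩ := exists_isUnit_mul_pow_add_mul hxy hcx
      obtain ⟨j, hj⟩ := Nat.exists_eq_add_of_le (Nat.find_min' hex ⟨w, d, hw, hc⟩ : k ≤ n)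
      obtain ⟨u', hu'⟩ := hu.exists_left_inv
      have heq : w * y ^ n + x * d = (w * u' * y ^ j) * f + x * (d - w * u' * y ^ j * b) := by
        rw [hj, pow_add]
        linear_combination (-w * y ^ k * y ^ j) * hu'
      have hmem : x * (d - w * u' * y ^ j * b) ∈ p := by
        rw [← add_sub_cancel_left ((w * u' * y ^ j) * f) (x * _), ← heq]
        exact p.sub_mem hc (p.mul_mem_left _ hf)
      rw [heq]
      exact Submodule.add_mem_sup (Submodule.smul_mem _ _ (Submodule.mem_span_singleton_self f))
        (hxp _ hmem)

/-- Quasi-reflexive modules over a regular local domain of dimension at most two are flat. -/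
theorem IsQuasiReflexive.flat {R : Type u} [CommRing R] [IsDomain R] (hR : IsRegularLocalRing R)
    (hdim : ringKrullDim R ≤ 2) {M : Type v} [AddCommGroup M] [Module R M]
    (hM : IsQuasiReflexive R M) : Module.Flat R M := by
  have htf := ((isQuasiReflexive_iff R M).1 hM).1
  have hprin (p : Ideal R) (hp : p.IsPrincipal) : Function.Injective (p.subtype.rTensor M) := by
    obtain ⟨a, rfl⟩ := hp
    rcases eq_or_ne a 0 with rfl | ha
    · have : Subsingleton (Submodule.span R {(0 : R)}) := by
        rw [Submodule.span_zero_singleton]; infer_instance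
      exact Function.injective_of_subsingleton _
    · exact rTensor_subtype_span_singleton_injective rfl fun m hm ↦ htf a m ha hm
  refine flat_of_forall_isPrime_rTensor_injective M fun p hp ↦ ?_
  have hspan := hR.spanFinrank_maximalIdeal
  rw [← hspan] at hdim
  have hle : (maximalIdeal R).spanFinrank ≤ 2 := by exact_mod_cast hdim
  by_cases hm : (maximalIdeal R).IsPrincipal
  · obtain ⟨x, hx⟩ := hm
    by_cases hxp : x ∈ p
    · have hle : maximalIdeal R ≤ p := hx.trans_le ((Ideal.span_singleton_le_iff_mem p).2 hxp)
      exact hprin p ⟨x, ((le_maximalIdeal hp.ne_top).antisymm hle).trans hx⟩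
    · have hx0 : maximalIdeal R = Ideal.span {x, 0} := by
        rw [Set.pair_comm, Ideal.span_insert_zero]; exact hx
      exact hprin p (isPrincipal_of_notMem hx0 p hxp)
  · have h2 : (maximalIdeal R).spanFinrank = 2 := by
      have h0 : (maximalIdeal R).spanFinrank ≠ 0 := fun h ↦ hm <| by
        rw [(Submodule.spanFinrank_eq_zero_iff_eq_bot (IsNoetherian.noetherian _)).1 h]
        infer_instance
      have h1 : (maximalIdeal R).spanFinrank ≠ 1 := fun h ↦
        hm ((Submodule.spanFinrank_eq_one_iff _).1 h).1
      omega
    have hht : (maximalIdeal R).height = 2 := by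
      rw [h2, ← maximalIdeal_height_eq_ringKrullDim] at hspan
      exact (WithBot.coe_injective hspan).symm
    obtain ⟨x, y, hxy⟩ : ∃ x y, maximalIdeal R = Ideal.span {x, y} := by
      have hfg : Submodule.FG (maximalIdeal R) := IsNoetherian.noetherian _
      obtain ⟨x, y, -, h⟩ := Set.ncard_eq_two.1 (hfg.generators_ncard.trans h2)
      exact ⟨x, y, by rw [← h]; exact (Submodule.span_generators _).symm⟩
    by_cases hxp : x ∈ p
    · by_cases hyp : y ∈ p
      · have hp_eq (q : Ideal R) (hq : q.IsPrime) (hx : x ∈ q) (hy : y ∈ q) :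
            q = maximalIdeal R := by
          refine (le_maximalIdeal hq.ne_top).antisymm ?_
          rw [hxy, Ideal.span_le]
          rintro _ (rfl | rfl) <;> assumption
        have hx0 : x ≠ 0 := by
          rintro rfl
          exact hm ⟨y, by rw [hxy, Ideal.span_insert_zero]⟩
        refine rTensor_subtype_span_pair_injective ((hp_eq p hp hxp hyp).trans hxy)
          (fun m ↦ htf x m hx0) fun m n hmn ↦
            hM.exists_eq_smul_of_smul_eq_smul hx0 (fun q hq hq1 hxq hyq ↦ ?_) hmn
        rw [hp_eq q hq hxq hyq, hht] at hq1
        exact absurd hq1 (by decide)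
      · exact hprin p (isPrincipal_of_notMem (hxy.trans (by rw [Set.pair_comm])) p hyp)
    · exact hprin p (isPrincipal_of_notMem hxy p hxp)

end RegularDimensionTwo

/-! ### Flatness of quasi-reflexive modules forces regularity. -/

section Converse

open IsLocalRing

variable {R : Type u} [CommRing R] [IsDomain R] [IsNoetherianRing R] [IsLocalRing R]

/-- Let `R` be a local unique factorization domain, and let `x, y, z` be linearly independent modulo
the square of the maximal ideal. Then the module of relations between `x, y, z` does not have
two generators. -/
lemma relations_not_generated_by_two {R : Type u} [CommRing R] [IsDomain R] [IsLocalRing R]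
    [UniqueFactorizationMonoid R] {x y z : R}
    (hx : x ∈ maximalIdeal R) (hy : y ∈ maximalIdeal R) (hz : z ∈ maximalIdeal R)
    (hind : ∀ a b c : R, a * x + b * y + c * z ∈ maximalIdeal R ^ 2 →
      a ∈ maximalIdeal R ∧ b ∈ maximalIdeal R ∧ c ∈ maximalIdeal R)
    (u v : Fin 3 → R) (hu : u 0 * x + u 1 * y + u 2 * z = 0)
    (hv : v 0 * x + v 1 * y + v 2 * z = 0)
    (hgen : ∀ w : Fin 3 → R, w 0 * x + w 1 * y + w 2 * z = 0 →
      ∃ a b : R, ∀ i, w i = a * u i + b * v i) : False := by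
  have one_notMem : (1 : R) ∉ maximalIdeal R := (Ideal.ne_top_iff_one _).1 Ideal.IsPrime.ne_top'
  have hx2 : x ∉ maximalIdeal R ^ 2 := fun h ↦ one_notMem (hind 1 0 0 (by simpa using h)).1
  have hxirr : Irreducible x := by
    refine ⟨hx, fun a b hab ↦ ?_⟩
    by_contra! hcon
    refine hx2 ?_
    rw [hab, pow_two]
    exact Ideal.mul_mem_mul hcon.1 hcon.2
  have hxp : Prime x := hxirr.prime
  have hxy : ¬ x ∣ y := by
    rintro ⟨c, rfl⟩
    exact one_notMem (hind (-c) 1 0 (by ring_nf; exact Ideal.zero_mem _)).2.1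
  have hxz : ¬ x ∣ z := by
    rintro ⟨c, rfl⟩
    exact one_notMem (hind (-c) 0 1 (by ring_nf; exact Ideal.zero_mem _)).2.2
  have hz0 : z ≠ 0 := by
    rintro rfl
    exact hxz (dvd_zero x)
  obtain ⟨-, hu1, hu2⟩ := hind _ _ _ (hu ▸ Ideal.zero_mem _)
  obtain ⟨-, hv1, hv2⟩ := hind _ _ _ (hv ▸ Ideal.zero_mem _)
  -- The 2×2 minors of `(u, v)` are proportional to `(x, y, z)`; as `x` is a prime not dividing `y`,
  -- the factor `l` lies in `R`.
  obtain ⟨l, hl⟩ : x ∣ u 1 * v 2 - u 2 * v 1 := by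
    refine (hxp.dvd_or_dvd ⟨u 2 * v 0 - u 0 * v 2, ?_⟩).resolve_right hxy
    linear_combination v 2 * hu - u 2 * hv
  have hl3 : u 0 * v 1 - u 1 * v 0 = l * z := by
    refine mul_left_cancel₀ hxp.ne_zero ?_
    linear_combination z * hl + v 1 * hu - u 1 * hv
  -- Koszul relations: their minors include `z ^ 2` and `x ^ 2`, so multiplicativity of determinants
  -- makes `l` divide `z` and `x`.
  obtain ⟨a₁, b₁, h₁⟩ := hgen ![0, z, -y] (by simp; ring)
  obtain ⟨a₂, b₂, h₂⟩ := hgen ![-z, 0, x] (by simp; ring)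
  obtain ⟨a₃, b₃, h₃⟩ := hgen ![y, -x, 0] (by simp; ring)
  simp only [Fin.forall_fin_succ, Fin.isValue, Matrix.cons_val_zero, Matrix.cons_val_succ,
    IsEmpty.forall_iff, and_true, Fin.succ_zero_eq_one, Fin.succ_one_eq_two] at h₁ h₂ h₃
  obtain ⟨h₁0, h₁1, h₁2⟩ := h₁
  obtain ⟨h₂0, h₂1, h₂2⟩ := h₂
  obtain ⟨h₃0, h₃1, h₃2⟩ := h₃
  have hzl : z = (a₁ * b₂ - a₂ * b₁) * l := by
    refine mul_right_cancel₀ hz0 ?_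
    rw [mul_assoc, ← hl3]
    linear_combination (a₂ * u 1 + b₂ * v 1) * h₁0 + z * h₁1 - (a₁ * u 1 + b₁ * v 1) * h₂0
  have hxl : x = (a₂ * b₃ - a₃ * b₂) * l := by
    refine mul_right_cancel₀ hxp.ne_zero ?_
    rw [mul_assoc, mul_comm l x, ← hl]
    linear_combination (a₃ * u 2 + b₃ * v 2) * h₂1 + x * h₂2 - (a₂ * u 2 + b₂ * v 2) * h₃1
  -- Either `l` is an associate of `x`, so `x ∣ z`, or `l` is a unit and `x` is a unit times a minor
  -- with entries in the maximal ideal.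
  rcases hxirr.isUnit_or_isUnit hxl with h | h
  · obtain ⟨c, hc⟩ := h.exists_left_inv
    refine hxz ⟨c * (a₁ * b₂ - a₂ * b₁), ?_⟩
    rw [hxl]
    linear_combination hzl - (a₁ * b₂ - a₂ * b₁) * l * hc
  · obtain ⟨c, hc⟩ := h.exists_left_inv
    refine hx2 ?_
    have : x = c * (u 1 * v 2 - u 2 * v 1) := by
      rw [hl]
      linear_combination -x * hc
    rw [this, pow_two]
    exact Ideal.mul_mem_left _ _ (Ideal.sub_mem _ (Ideal.mul_mem_mul hu1 hv2)
      (Ideal.mul_mem_mul hu2 hv1))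

/-- Over a local domain, the module of relations between three elements, not all zero, is generated
by two elements if it is flat. -/
lemma exists_generators_relations {x y z : R} (hx : x ≠ 0)
    (L : (Fin 3 → R) →ₗ[R] R) (hL : ∀ w, L w = w 0 * x + w 1 * y + w 2 * z)
    [Module.Flat R (LinearMap.ker L)] :
    ∃ u ∈ LinearMap.ker L, ∃ v ∈ LinearMap.ker L, ∀ w ∈ LinearMap.ker L,
      ∃ a b : R, w = a • u + b • v := by
  have hfree : Module.Free R (LinearMap.ker L) := Module.free_of_flat_of_isLocalRing
  have hrange : Module.finrank R (LinearMap.range L) = 1 := by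
    refine le_antisymm ((Submodule.finrank_le _).trans (Module.finrank_self R).le) ?_
    have : Nontrivial (LinearMap.range L) := by
      rw [Submodule.nontrivial_iff_ne_bot]
      intro h
      refine hx ((Submodule.mem_bot R).1 (h ▸ ⟨![1, 0, 0], ?_⟩))
      simp [hL]
    exact Module.finrank_pos
  have hker : Module.finrank R (LinearMap.ker L) = 2 := by
    have h := Submodule.finrank_quotient_add_finrank (LinearMap.ker L)
    rw [L.quotKerEquivRange.finrank_eq, hrange, Module.finrank_fin_fun] at h
    omega
  let B := Module.finBasisOfFinrankEq R (LinearMap.ker L) hker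
  refine ⟨B 0, (B 0).2, B 1, (B 1).2, fun w hw ↦ ⟨B.repr ⟨w, hw⟩ 0, B.repr ⟨w, hw⟩ 1, ?_⟩⟩
  have h := B.sum_repr ⟨w, hw⟩
  rw [Fin.sum_univ_two] at h
  exact (congrArg Subtype.val h).symm

/-- If the maximal ideal of a Noetherian local ring is not generated by two elements, then it
contains three elements which are linearly independent modulo its square. -/
lemma exists_linearIndependent_mod_sq {R : Type u} [CommRing R] [IsNoetherianRing R] [IsLocalRing R]
    (h : 2 < (maximalIdeal R).spanFinrank) :
    ∃ x ∈ maximalIdeal R, ∃ y ∈ maximalIdeal R, ∃ z ∈ maximalIdeal R,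
      ∀ a b c : R, a * x + b * y + c * z ∈ maximalIdeal R ^ 2 →
        a ∈ maximalIdeal R ∧ b ∈ maximalIdeal R ∧ c ∈ maximalIdeal R := by
  rw [spanFinrank_maximalIdeal_eq_finrank_cotangentSpace] at h
  obtain ⟨g, hg⟩ := exists_linearIndependent_of_le_finrank (Nat.succ_le_of_lt h)
  choose X hX using fun i ↦ (maximalIdeal R).toCotangent_surjective (g i)
  refine ⟨X 0, (X 0).2, X 1, (X 1).2, X 2, (X 2).2, fun a b c habc ↦ ?_⟩
  have h0 : (maximalIdeal R).toCotangent (a • X 0 + b • X 1 + c • X 2) = 0 :=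
    (Ideal.toCotangent_eq_zero _ _).2 habc
  rw [map_add, map_add, map_smul, map_smul, map_smul, hX, hX, hX] at h0
  have h1 := Fintype.linearIndependent_iff.1 hg ![residue R a, residue R b, residue R c] (by
    rw [Fin.sum_univ_three]
    exact h0)
  simp only [← residue_eq_zero_iff]
  exact ⟨h1 0, h1 1, h1 2⟩

variable [IsIntegrallyClosed R]

/-- If all quasi-reflexive modules are flat, then primes of height one are principal. -/
lemma isPrincipal_of_height_eq_one_of_forall_flat
    (hflat : ∀ (M : Type (max u v)) [AddCommGroup M] [Module R M],
      IsQuasiReflexive R M → Module.Flat R M)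
    (p : Ideal R) [p.IsPrime] (hp : p.height = 1) : p.IsPrincipal := by
  -- The lift only moves `p` into the universe of the hypothesis.
  have := hflat (ULift.{v} p)
    ((isQuasiReflexive_of_height_eq_one p hp).of_linearEquiv ULift.moduleEquiv.symm)
  have : Module.Flat R p := Module.Flat.of_ulift
  have : Module.Free R p := Module.free_of_flat_of_isLocalRing
  obtain ⟨v, hv⟩ := finrank_le_one_iff.1
    ((Submodule.finrank_le p).trans (Module.finrank_self R).le)
  refine ⟨v, le_antisymm (fun w hw ↦ ?_) ((Ideal.span_singleton_le_iff_mem p).2 v.2)⟩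
  obtain ⟨c, hc⟩ := hv ⟨w, hw⟩
  exact Submodule.mem_span_singleton.2 ⟨c, congrArg Subtype.val hc⟩

/-- If all quasi-reflexive modules are flat, then the maximal ideal has at most two generators. -/
lemma spanFinrank_maximalIdeal_le_two_of_forall_flat
    (hflat : ∀ (M : Type (max u v)) [AddCommGroup M] [Module R M],
      IsQuasiReflexive R M → Module.Flat R M) : (maximalIdeal R).spanFinrank ≤ 2 := by
  by_contra! hcon
  obtain ⟨x, hx, y, hy, z, hz, hind⟩ := exists_linearIndependent_mod_sq hcon
  have : UniqueFactorizationMonoid R := .of_forall_isPrincipal_of_height_eq_one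
    fun p _ ↦ isPrincipal_of_height_eq_one_of_forall_flat.{u, v} hflat p
  have hx0 : x ≠ 0 := by
    rintro rfl
    exact (Ideal.ne_top_iff_one _).1 Ideal.IsPrime.ne_top' (hind 1 0 0 (by simp)).1
  let L : (Fin 3 → R) →ₗ[R] R := Fintype.linearCombination R ![x, y, z]
  have hL (w : Fin 3 → R) : L w = w 0 * x + w 1 * y + w 2 * z := by
    simp [L, Fintype.linearCombination_apply, Fin.sum_univ_three]
  have hK : IsQuasiReflexive R (LinearMap.ker L) := by
    refine (isQuasiReflexive_of_flat (Fin 3 → R)).submodule _ fun s m hs hm ↦ ?_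
    rw [LinearMap.mem_ker, map_smul] at hm
    exact (smul_eq_zero.1 hm).resolve_left hs
  have := hflat (ULift.{v} (LinearMap.ker L)) (hK.of_linearEquiv ULift.moduleEquiv.symm)
  have : Module.Flat R (LinearMap.ker L) := Module.Flat.of_ulift
  obtain ⟨u, hu, v, hv, huv⟩ := exists_generators_relations hx0 L hL
  refine relations_not_generated_by_two hx hy hz hind u v ((hL u).symm.trans hu)
    ((hL v).symm.trans hv) fun w hw ↦ ?_
  obtain ⟨a, b, rfl⟩ := huv w ((hL w).trans hw)
  exact ⟨a, b, fun i ↦ rfl⟩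

/-- If all quasi-reflexive modules are flat, then `R` is regular of dimension at most two. -/
theorem isRegularLocalRing_and_ringKrullDim_le_two_of_forall_flat (hdim : 0 < ringKrullDim R)
    (hflat : ∀ (M : Type (max u v)) [AddCommGroup M] [Module R M],
      IsQuasiReflexive R M → Module.Flat R M) :
    IsRegularLocalRing R ∧ ringKrullDim R ≤ 2 := by
  have h2 := spanFinrank_maximalIdeal_le_two_of_forall_flat.{u, v} hflat
  refine ⟨.of_spanFinrank_maximalIdeal_le R ?_, (ringKrullDim_le_spanFinrank_maximalIdeal R).trans
    (by exact_mod_cast h2)⟩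
  rw [← maximalIdeal_height_eq_ringKrullDim] at hdim ⊢
  have hpos : 1 ≤ (maximalIdeal R).height := Order.one_le_iff_pos.2 (by exact_mod_cast hdim)
  -- In dimension one the bound of two generators is too weak, but the maximal ideal is then itself
  -- a height-one prime, hence principal.
  rcases hpos.eq_or_lt with h1 | h1
  · have hp := isPrincipal_of_height_eq_one_of_forall_flat.{u, v} hflat _ h1.symm
    have hne : maximalIdeal R ≠ ⊥ := Ideal.ne_bot_of_height_eq_one h1.symm
    rw [(Submodule.spanFinrank_eq_one_iff _).2 ⟨hp, hne⟩, ← h1]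
    rfl
  · have : (2 : ℕ∞) ≤ (maximalIdeal R).height := by
      have := Order.add_one_le_of_lt h1
      rwa [one_add_one_eq_two] at this
    calc ((maximalIdeal R).spanFinrank : WithBot ℕ∞) ≤ (2 : ℕ∞) := by exact_mod_cast h2
      _ ≤ _ := by exact_mod_cast this

end Converse

theorem mainTheorem12 (R : Type u) [CommRing R] [IsDomain R] [IsNoetherianRing R]
    [IsLocalRing R] [IsIntegrallyClosed R] (hdim : 0 < ringKrullDim R) :
    List.TFAE [
      ∀ (M : Type (max u v)) [AddCommGroup M] [Module R M],
        IsQuasiReflexive R M → Module.Flat R M,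
      ∀ (M : Type (max u v)) [AddCommGroup M] [Module R M],
        IsQuasiReflexive R M ↔ Module.Flat R M,
      IsRegularLocalRing R ∧ ringKrullDim R ≤ 2] := by
  tfae_have 1 → 3 := isRegularLocalRing_and_ringKrullDim_le_two_of_forall_flat.{u, v} hdim
  tfae_have 3 → 2 := fun ⟨hR, h2⟩ M _ _ ↦ ⟨fun h ↦ h.flat hR h2, fun _ ↦ isQuasiReflexive_of_flat M⟩
  tfae_have 2 → 1 := fun h M _ _ ↦ (h M).1
  tfae_finish
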